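/- Let $A\in\mathbb{R}^{n\times n}$, $B\in\mathbb{R}^{n\times m}$, and consider either the continuous-time (CT) or the discrete-time (DT) model. Call a real square matrix stable if all its complex eigenvalues have negative real part (CT), respectively if its spectral radius is less than $1$ (DT), and let $\mathcal{K}=\{K\in\mathbb{R}^{m\times n} : A+BK \text{ is stable}\}$ be the set of stabilizing gains. Write $\langle U,V\rangle=\mathrm{Tr}(U^{\mathsf T}V)$. Assume: 1. $Q\in\mathbb{R}^{n\times n}$ and $W\in\mathbb{R}^{n\times n}$ are symmetric positive semidefinite and nonzero, $R\in\mathbb{R}^{m\times m}$ is symmetric positive definite, $(A,B)$ is stabilizable ($A+BK$ is stable for some $K$), and $(Q^{1/2},A)$ is detectable ($A+LQ^{1/2}$ is stable for some $L$). 2. For every $K\in\mathbb{R}^{m\times n}$ and every symmetric solution $X$ of the Lyapunov equation $$\Psi\left(\begin{bmatrix}A+BK\\ I\end{bmatrix}X\begin{bmatrix}A+BK\\ I\end{bmatrix}^{\mathsf T}\right)+W=0,\qquad \Psi\left(\begin{bmatrix}F&G\\G^{\mathsf T}&H\end{bmatrix}\right)=\begin{cases}G+G^{\mathsf T}&\text{(CT)}\\F-H&\text{(DT)},\end{cases}$$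 one has $K\in\mathcal{K}$ if and only if $X\succ0$. Then, for every $K\in\mathcal{K}$, the Lyapunov equation has a unique symmetric solution $X_K$, and the LQR cost $J(K)=\langle Q+K^{\mathsf T}RK,X_K\rangle$ is differentiable at every $K\in\mathcal{K}$. There is a unique optimal gain $K^\star$, that is, a unique minimizer of $J$ over $\mathcal{K}$. With $J^\star=\inf_{K\in\mathcal{K}}J(K)=J(K^\star)$ and $X^\star=X_{K^\star}$, every $K\in\mathcal{K}$ satisfies $$J(K)-J^\star\ \ge\ \langle R,(K-K^\star)X_K(K-K^\star)^{\mathsf T}\rangle,$$ $$J(K)-J^\star\ \le\ \langle \nabla J(K)\,X_K^{-1}X^\star,\;K-K^\star\rangle,$$ where $\nabla J(K)\in\mathbb{R}^{m\times n}$ is the gradient with respect to $\langle\cdot,\cdot\rangle$. -/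

import Mathlib

open scoped Matrix MatrixOrder

namespace LQR

noncomputable section

/-- The two time models: continuous time and discrete time. -/
inductive TimeModel where
  | ct
  | dt

/-- Frobenius inner product `⟨U, V⟩ = Tr (Uᵀ V)` of real matrices. -/
def frob {p q : ℕ} (U V : Matrix (Fin p) (Fin q) ℝ) : ℝ := (Uᵀ * V).trace

/-- A real square matrix is stable: in continuous time all its complex eigenvalues have negative
real part (Hurwitz), in discrete time its spectral radius is less than one (Schur). -/
def IsStable {n : ℕ} (τ : TimeModel) (M : Matrix (Fin n) (Fin n) ℝ) : Prop :=
  match τ with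
  | .ct => ∀ z ∈ spectrum ℂ (M.map (fun x : ℝ => (x : ℂ))), z.re < 0
  | .dt => spectralRadius ℂ (M.map (fun x : ℝ => (x : ℂ))) < 1

/-- The set `𝒦` of stabilizing gains. -/
def stabilizingGains {n m : ℕ} (τ : TimeModel) (A : Matrix (Fin n) (Fin n) ℝ)
    (B : Matrix (Fin n) (Fin m) ℝ) : Set (Matrix (Fin m) (Fin n) ℝ) :=
  {K | IsStable τ (A + B * K)}

/-- `(A, B)` is stabilizable: some state feedback `K` makes `A + B K` stable. -/
def IsStabilizable {n m : ℕ} (τ : TimeModel) (A : Matrix (Fin n) (Fin n) ℝ)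
    (B : Matrix (Fin n) (Fin m) ℝ) : Prop :=
  ∃ K : Matrix (Fin m) (Fin n) ℝ, IsStable τ (A + B * K)

/-- `(C, A)` is detectable: some output injection `L` makes `A + L C` stable. -/
def IsDetectable {n p : ℕ} (τ : TimeModel) (C : Matrix (Fin p) (Fin n) ℝ)
    (A : Matrix (Fin n) (Fin n) ℝ) : Prop :=
  ∃ L : Matrix (Fin n) (Fin p) ℝ, IsStable τ (A + L * C)

/-- The standing assumptions on the problem data; `CFC.sqrt Q` is the positive semidefinite
square root of `Q`. -/
structure StandardAssumption {n m : ℕ} (τ : TimeModel) (A : Matrix (Fin n) (Fin n) ℝ)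
    (B : Matrix (Fin n) (Fin m) ℝ) (Q : Matrix (Fin n) (Fin n) ℝ)
    (R : Matrix (Fin m) (Fin m) ℝ) (W : Matrix (Fin n) (Fin n) ℝ) : Prop where
  Q_posSemidef : Q.PosSemidef
  Q_ne_zero : Q ≠ 0
  R_posDef : R.PosDef
  W_posSemidef : W.PosSemidef
  W_ne_zero : W ≠ 0
  stabilizable : IsStabilizable τ A B
  detectable : IsDetectable τ (CFC.sqrt Q) A

/-- The linear operator `Ψ` on symmetric block matrices `[F, G; Gᵀ, H]`:
`G + Gᵀ` in continuous time, `F - H` in discrete time. -/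
def Psi {n : ℕ} (τ : TimeModel) (M : Matrix (Fin n ⊕ Fin n) (Fin n ⊕ Fin n) ℝ) :
    Matrix (Fin n) (Fin n) ℝ :=
  match τ with
  | .ct => M.toBlocks₁₂ + M.toBlocks₁₂ᵀ
  | .dt => M.toBlocks₁₁ - M.toBlocks₂₂

/-- The symmetric matrix `X` solves the Lyapunov equation
`Ψ ([A + B K; I] X [A + B K; I]ᵀ) + W = 0` associated with the gain `K`. -/
def IsLyapunovSolution {n m : ℕ} (τ : TimeModel) (A : Matrix (Fin n) (Fin n) ℝ)
    (B : Matrix (Fin n) (Fin m) ℝ) (W : Matrix (Fin n) (Fin n) ℝ)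
    (K : Matrix (Fin m) (Fin n) ℝ) (X : Matrix (Fin n) (Fin n) ℝ) : Prop :=
  X.IsSymm ∧
    Psi τ (Matrix.fromRows (A + B * K) 1 * X * (Matrix.fromRows (A + B * K) 1)ᵀ) + W = 0

/-- For every gain `K` and every solution `X` of the associated Lyapunov equation, `K` is
stabilizing if and only if `X` is positive definite. -/
def LyapunovPosDefAssumption {n m : ℕ} (τ : TimeModel) (A : Matrix (Fin n) (Fin n) ℝ)
    (B : Matrix (Fin n) (Fin m) ℝ) (W : Matrix (Fin n) (Fin n) ℝ) : Prop :=
  ∀ (K : Matrix (Fin m) (Fin n) ℝ) (X : Matrix (Fin n) (Fin n) ℝ),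
    IsLyapunovSolution τ A B W K X → (K ∈ stabilizingGains τ A B ↔ X.PosDef)

open Classical in
/-- The Lyapunov variable `X_K`: the solution of the Lyapunov equation associated with `K`
(it exists and is unique when `K` is stabilizing; the value `0` is used if there is none). -/
def lyapunovVar {n m : ℕ} (τ : TimeModel) (A : Matrix (Fin n) (Fin n) ℝ)
    (B : Matrix (Fin n) (Fin m) ℝ) (W : Matrix (Fin n) (Fin n) ℝ)
    (K : Matrix (Fin m) (Fin n) ℝ) : Matrix (Fin n) (Fin n) ℝ :=
  if h : ∃ X, IsLyapunovSolution τ A B W K X then h.choose else 0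

/-- The LQR cost `J(K) = ⟨Q + Kᵀ R K, X_K⟩`. -/
def cost {n m : ℕ} (τ : TimeModel) (A : Matrix (Fin n) (Fin n) ℝ)
    (B : Matrix (Fin n) (Fin m) ℝ) (Q : Matrix (Fin n) (Fin n) ℝ)
    (R : Matrix (Fin m) (Fin m) ℝ) (W : Matrix (Fin n) (Fin n) ℝ)
    (K : Matrix (Fin m) (Fin n) ℝ) : ℝ :=
  frob (Q + Kᵀ * R * K) (lyapunovVar τ A B W K)

/-- The optimal value `J⋆` of the minimization of `J` over the stabilizing gains. -/
def optimalValue {n m : ℕ} (τ : TimeModel) (A : Matrix (Fin n) (Fin n) ℝ)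
    (B : Matrix (Fin n) (Fin m) ℝ) (Q : Matrix (Fin n) (Fin n) ℝ)
    (R : Matrix (Fin m) (Fin m) ℝ) (W : Matrix (Fin n) (Fin n) ℝ) : ℝ :=
  sInf (cost τ A B Q R W '' stabilizingGains τ A B)

/-- `K` is an optimal gain: it is stabilizing and minimizes `J` over the stabilizing gains. -/
def IsOptimalGain {n m : ℕ} (τ : TimeModel) (A : Matrix (Fin n) (Fin n) ℝ)
    (B : Matrix (Fin n) (Fin m) ℝ) (Q : Matrix (Fin n) (Fin n) ℝ)
    (R : Matrix (Fin m) (Fin m) ℝ) (W : Matrix (Fin n) (Fin n) ℝ)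
    (K : Matrix (Fin m) (Fin n) ℝ) : Prop :=
  K ∈ stabilizingGains τ A B ∧ IsMinOn (cost τ A B Q R W) (stabilizingGains τ A B) K

/-- The gradient of a real function of a matrix with respect to the Frobenius inner product,
that is, the matrix of its partial derivatives (meaningful where `f` is differentiable). -/
def matrixGradient {p q : ℕ} (f : Matrix (Fin p) (Fin q) ℝ → ℝ) (K : Matrix (Fin p) (Fin q) ℝ) :
    Matrix (Fin p) (Fin q) ℝ :=
  Matrix.of fun i j => fderiv ℝ f K (Matrix.single i j 1)

end

end LQR

/-! The cost is an exact quadratic along a duality. The operators `lyapOp τ F` and `lyapOp τ Fᵀ` are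
adjoint for `frob`, so for any `P` one has J(K) = ⟨P, W⟩ + ⟨V_P(K), X_K⟩, where V_P =
`valueResidual` is quadratic in K with curvature S = `inputWeight` ⪰ R when P ⪰ 0. If V_P(K) = 0,
expanding around K gives the performance difference formula `cost_sub_cost`: J(K') - J(K) = 2⟨E
X_{K'}, K' - K⟩ + ⟨S, (K' - K) X_{K'} (K' - K)ᵀ⟩, with E = `crossWeight` + S K.

Taking for P a stabilizing Riccati solution (`exists_riccati_solution`) makes E vanish at its gain.
Only the square is left: this gives optimality, uniqueness (S and X_{K'} are positive definite) and,
by S ⪰ R, the lower bound. Taking instead the value matrix of an arbitrary K and K' = K⋆, dropping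
the square gives J(K) - J⋆ ≤ 2⟨E X⋆, K - K⋆⟩. This is the upper bound, because ∇J(K) = 2 E X_K
(`hasFDerivAt_cost`). -/

namespace LQR

open Filter Topology

/-! ### Stability: eigenvectors, powers and the Cayley transform -/

theorem mem_spectrum_iff_exists_mulVec {n : ℕ} (M : Matrix (Fin n) (Fin n) ℂ) (z : ℂ) :
    z ∈ spectrum ℂ M ↔ ∃ v, v ≠ 0 ∧ M *ᵥ v = z • v := by
  rw [spectrum.mem_iff, Matrix.isUnit_iff_isUnit_det, isUnit_iff_ne_zero, not_not,
    ← Matrix.exists_mulVec_eq_zero_iff]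
  refine exists_congr fun v => and_congr_right fun _ => ?_
  rw [Matrix.sub_mulVec, sub_eq_zero, Algebra.algebraMap_eq_smul_one, Matrix.smul_mulVec,
    Matrix.one_mulVec, eq_comm]

/-- A complex eigenvector of a real matrix, written through its real and imaginary parts. -/
theorem mem_spectrum_map_iff {n : ℕ} (M : Matrix (Fin n) (Fin n) ℝ) (z : ℂ) :
    z ∈ spectrum ℂ (M.map (fun x : ℝ => (x : ℂ))) ↔
      ∃ a b : Fin n → ℝ, (a ≠ 0 ∨ b ≠ 0) ∧ M *ᵥ a = z.re • a - z.im • b ∧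
        M *ᵥ b = z.im • a + z.re • b := by
  have key : ∀ v : Fin n → ℂ, M.map (fun x : ℝ => (x : ℂ)) *ᵥ v = z • v ↔
      (M *ᵥ fun i => (v i).re) = (z.re • fun i => (v i).re) - (z.im • fun i => (v i).im) ∧
      (M *ᵥ fun i => (v i).im) = (z.im • fun i => (v i).re) + (z.re • fun i => (v i).im) := by
    intro v
    simp only [funext_iff, ← forall_and]
    refine forall_congr' fun i => ?_
    rw [Complex.ext_iff]
    simp [Matrix.mulVec, dotProduct, add_comm]
  rw [mem_spectrum_iff_exists_mulVec]
  constructor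
  · rintro ⟨v, hv, h⟩
    refine ⟨fun i => (v i).re, fun i => (v i).im, ?_, (key v).1 h⟩
    by_contra! hc
    exact hv (funext fun i => Complex.ext (congrFun hc.1 i) (congrFun hc.2 i))
  · rintro ⟨a, b, h0, h⟩
    refine ⟨fun i => ⟨a i, b i⟩, ?_, (key _).2 h⟩
    intro hv
    rcases h0 with h0 | h0
    · exact h0 (funext fun i => congrArg Complex.re (congrFun hv i))
    · exact h0 (funext fun i => congrArg Complex.im (congrFun hv i))

section Gelfand

attribute [local instance] Matrix.linftyOpNormedAddCommGroup Matrix.linftyOpNormedRing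
  Matrix.linftyOpNormedAlgebra

theorem spectralRadius_lt_one_iff {n : ℕ} (M : Matrix (Fin n) (Fin n) ℂ) :
    spectralRadius ℂ M < 1 ↔ ∀ z ∈ spectrum ℂ M, ‖z‖ < 1 := by
  constructor
  · intro h z hz
    have h1 : (‖z‖₊ : ENNReal) ≤ spectralRadius ℂ M :=
      le_iSup₂ (f := fun (k : ℂ) (_ : k ∈ spectrum ℂ M) => (‖k‖₊ : ENNReal)) z hz
    have h2 := h1.trans_lt h
    exact_mod_cast h2
  · intro h
    -- The spectrum is empty only for n = 0, where the radius is a supremum over the empty set.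
    rcases (spectrum ℂ M).eq_empty_or_nonempty with h0 | h0
    · simp [spectralRadius, h0]
    · have := spectrum.spectralRadius_lt_of_forall_lt_of_nonempty (𝕜 := ℂ) (a := M) h0 (r := 1)
        (fun z hz => by exact_mod_cast h z hz)
      simpa using this

/-- By Gelfand's formula ‖M ^ k‖ ≤ r ^ k eventually, for some r < 1. The submultiplicative norm
stays local: the conclusion is purely topological. -/
theorem tendsto_pow_of_spectralRadius_lt_one {n : ℕ} (M : Matrix (Fin n) (Fin n) ℂ)
    (h : spectralRadius ℂ M < 1) : Tendsto (fun k : ℕ => M ^ k) atTop (𝓝 0) := by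
  obtain ⟨r, hr1, hr2⟩ := ENNReal.lt_iff_exists_nnreal_btwn.1 h
  have hr2' : r < 1 := by exact_mod_cast hr2
  have h1 := (spectrum.pow_nnnorm_pow_one_div_tendsto_nhds_spectralRadius M).eventually_lt_const hr1
  have h2 : Tendsto (fun k : ℕ => ‖M ^ k‖) atTop (𝓝 0) := by
    refine squeeze_zero' (Eventually.of_forall fun _ => norm_nonneg _) ?_
      (tendsto_pow_atTop_nhds_zero_of_lt_one r.2 hr2')
    filter_upwards [h1, eventually_gt_atTop 0] with k hk hk0
    have hk0' : (0 : ℝ) < k := by exact_mod_cast hk0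
    have h3 := ENNReal.rpow_le_rpow hk.le hk0'.le
    rw [← ENNReal.rpow_mul, one_div, inv_mul_cancel₀ hk0'.ne', ENNReal.rpow_one,
      ENNReal.rpow_natCast] at h3
    have h4 : ‖M ^ k‖₊ ≤ r ^ k := by exact_mod_cast h3
    exact_mod_cast h4
  exact tendsto_zero_iff_norm_tendsto_zero.2 h2

end Gelfand

theorem isStable_dt_iff {n : ℕ} (M : Matrix (Fin n) (Fin n) ℝ) :
    IsStable .dt M ↔ ∀ z ∈ spectrum ℂ (M.map (fun x : ℝ => (x : ℂ))), ‖z‖ < 1 :=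
  spectralRadius_lt_one_iff _

theorem IsStable.tendsto_pow {n : ℕ} {M : Matrix (Fin n) (Fin n) ℝ} (h : IsStable .dt M) :
    Tendsto (fun k : ℕ => M ^ k) atTop (𝓝 0) := by
  have h1 := tendsto_pow_of_spectralRadius_lt_one _ h
  have h2 : Tendsto (fun N : Matrix (Fin n) (Fin n) ℂ => N.map Complex.re) (𝓝 0) (𝓝 0) := by
    have : Continuous (fun N : Matrix (Fin n) (Fin n) ℂ => N.map Complex.re) :=
      continuous_id.matrix_map Complex.continuous_re
    have h3 := this.tendsto 0
    rwa [show (0 : Matrix (Fin n) (Fin n) ℂ).map Complex.re = 0 by ext; simp] at h3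
  have h3 := h2.comp h1
  refine h3.congr fun k => ?_
  have h4 : (M.map (fun x : ℝ => (x : ℂ))) ^ k = (M ^ k).map (fun x : ℝ => (x : ℂ)) :=
    (map_pow (Complex.ofRealHom.mapMatrix (m := Fin n)) M k).symm
  ext i j
  simp [h4]

theorem IsStable.isUnit_det_one_sub {n : ℕ} {F : Matrix (Fin n) (Fin n) ℝ}
    (h : IsStable .ct F) : IsUnit (1 - F).det := by
  rw [isUnit_iff_ne_zero]
  intro h0
  obtain ⟨a, ha, h1⟩ := Matrix.exists_mulVec_eq_zero_iff.2 h0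
  rw [Matrix.sub_mulVec, Matrix.one_mulVec, sub_eq_zero] at h1
  have h2 : (1 : ℂ) ∈ spectrum ℂ (F.map (fun x : ℝ => (x : ℂ))) :=
    (mem_spectrum_map_iff F 1).2 ⟨a, 0, Or.inl ha, by simp [← h1], by simp⟩
  have h3 := h 1 h2
  norm_num at h3

/-- The Cayley transform of a Hurwitz matrix is a Schur matrix. -/
theorem IsStable.cayley {n : ℕ} {F C : Matrix (Fin n) (Fin n) ℝ}
    (h : IsStable .ct F) (hC : (1 - F) * C = 1 + F) : IsStable .dt C := by
  rw [isStable_dt_iff]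
  intro z hz
  obtain ⟨v, hv, hz⟩ := (mem_spectrum_iff_exists_mulVec _ _).1 hz
  have hC' : (1 - F.map (fun x : ℝ => (x : ℂ))) * C.map (fun x : ℝ => (x : ℂ)) =
      1 + F.map (fun x : ℝ => (x : ℂ)) := by
    have := congrArg (Complex.ofRealHom.mapMatrix (m := Fin n)) hC
    rwa [map_mul, map_sub, map_add, map_one] at this
  have h1 := congrArg (· *ᵥ v) hC'
  simp only [← Matrix.mulVec_mulVec, hz, Matrix.sub_mulVec, Matrix.add_mulVec, Matrix.one_mulVec,
    Matrix.mulVec_smul] at h1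
  set u := F.map (fun x : ℝ => (x : ℂ)) *ᵥ v with hu
  have h2 : (z + 1) • u = (z - 1) • v := by
    rw [smul_sub] at h1
    rw [add_smul, sub_smul, one_smul, one_smul]
    linear_combination (exp := 1) -h1
  have h3 : z + 1 ≠ 0 := by
    intro h3
    have h4 : z = -1 := by linear_combination h3
    rw [h3, h4, zero_smul] at h2
    rcases smul_eq_zero.1 h2.symm with h5 | h5
    · norm_num at h5
    · exact hv h5
  -- The real part of (z - 1)/(z + 1) has the sign of |z|² - 1.
  have h4 : ((z - 1) / (z + 1)) ∈ spectrum ℂ (F.map (fun x : ℝ => (x : ℂ))) := by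
    refine (mem_spectrum_iff_exists_mulVec _ _).2 ⟨v, hv, ?_⟩
    rw [← hu, div_eq_inv_mul, mul_smul, ← h2, smul_smul, inv_mul_cancel₀ h3, one_smul]
  have h5 := h _ h4
  have h6 : 0 < Complex.normSq (z + 1) := Complex.normSq_pos.2 h3
  rw [Complex.div_re, ← add_div, div_neg_iff] at h5
  have h7 : (z - 1).re * (z + 1).re + (z - 1).im * (z + 1).im < 0 := by
    rcases h5 with h5 | h5
    · exact absurd h5.2 (not_lt.2 h6.le)
    · exact h5.1
  have h8 : ‖z‖ ^ 2 < 1 := by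
    rw [Complex.sq_norm, Complex.normSq_apply]
    simp at h7
    nlinarith
  nlinarith [norm_nonneg z]

/-! ### Lyapunov operators: adjoint, injectivity, positivity -/

theorem isClosed_setOf_posSemidef (n : ℕ) :
    IsClosed {P : Matrix (Fin n) (Fin n) ℝ | P.PosSemidef} := by
  simp only [Matrix.posSemidef_iff_dotProduct_mulVec, Set.ofPred_and, Set.ofPred_forall]
  refine IsClosed.inter ?_ (isClosed_iInter fun v => ?_)
  · exact isClosed_eq (by fun_prop) continuous_id
  · exact isClosed_le continuous_const (by fun_prop)

/-- The Lyapunov operator, `P ↦ Fᵀ P + P F` in continuous time and `P ↦ Fᵀ P F - P` in discrete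
time. -/
def lyapOp {n : ℕ} (τ : TimeModel) (F : Matrix (Fin n) (Fin n) ℝ) :
    Matrix (Fin n) (Fin n) ℝ →ₗ[ℝ] Matrix (Fin n) (Fin n) ℝ :=
  match τ with
  | .ct => LinearMap.mulLeft ℝ Fᵀ + LinearMap.mulRight ℝ F
  | .dt => LinearMap.mulLeft ℝ Fᵀ ∘ₗ LinearMap.mulRight ℝ F - LinearMap.id

theorem lyapOp_ct {n : ℕ} (F P : Matrix (Fin n) (Fin n) ℝ) :
    lyapOp .ct F P = Fᵀ * P + P * F := rfl

theorem lyapOp_dt {n : ℕ} (F P : Matrix (Fin n) (Fin n) ℝ) :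
    lyapOp .dt F P = Fᵀ * (P * F) - P := rfl

theorem transpose_lyapOp {n : ℕ} (τ : TimeModel) (F P : Matrix (Fin n) (Fin n) ℝ) :
    (lyapOp τ F P)ᵀ = lyapOp τ F Pᵀ := by
  cases τ
  · simp [lyapOp_ct, add_comm]
  · simp [lyapOp_dt, Matrix.mul_assoc]

theorem continuous_lyapOp {n : ℕ} (τ : TimeModel) :
    Continuous fun p : Matrix (Fin n) (Fin n) ℝ × Matrix (Fin n) (Fin n) ℝ =>
      lyapOp τ p.1 p.2 := by
  cases τ
  · simp only [lyapOp_ct]; fun_prop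
  · simp only [lyapOp_dt]; fun_prop

/-- The transpose matters: the equation for `X` is dual to the one for the value matrix `P`. -/
theorem isLyapunovSolution_iff {n m : ℕ} (τ : TimeModel) (A : Matrix (Fin n) (Fin n) ℝ)
    (B : Matrix (Fin n) (Fin m) ℝ) (W : Matrix (Fin n) (Fin n) ℝ)
    (K : Matrix (Fin m) (Fin n) ℝ) (X : Matrix (Fin n) (Fin n) ℝ) :
    IsLyapunovSolution τ A B W K X ↔ X.IsSymm ∧ lyapOp τ (A + B * K)ᵀ X = -W := by
  refine and_congr_right fun hX => ?_
  rw [← add_eq_zero_iff_eq_neg]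
  refine Eq.congr ?_ rfl
  congr 1
  cases τ
  · simp only [Psi, lyapOp_ct, Matrix.fromRows_mul, Matrix.transpose_fromRows]
    simp [hX.eq]
  · simp only [Psi, lyapOp_dt, Matrix.fromRows_mul, Matrix.transpose_fromRows]
    simp [Matrix.mul_assoc]

section frob

variable {p q : ℕ}

theorem frob_eq_sum (U V : Matrix (Fin p) (Fin q) ℝ) : frob U V = ∑ i, ∑ j, U i j * V i j := by
  rw [frob, Matrix.trace, Finset.sum_comm]
  simp [Matrix.mul_apply]

theorem frob_add_left (U U' V : Matrix (Fin p) (Fin q) ℝ) :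
    frob (U + U') V = frob U V + frob U' V := by
  simp [frob, Matrix.add_mul]

theorem frob_sub_left (U U' V : Matrix (Fin p) (Fin q) ℝ) :
    frob (U - U') V = frob U V - frob U' V := by
  simp [frob, Matrix.sub_mul]

theorem frob_add_right (U V V' : Matrix (Fin p) (Fin q) ℝ) :
    frob U (V + V') = frob U V + frob U V' := by
  simp [frob, Matrix.mul_add]

theorem frob_sub_right (U V V' : Matrix (Fin p) (Fin q) ℝ) :
    frob U (V - V') = frob U V - frob U V' := by
  simp [frob, Matrix.mul_sub]

theorem frob_neg_right (U V : Matrix (Fin p) (Fin q) ℝ) : frob U (-V) = -frob U V := by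
  simp [frob]

theorem frob_smul_left (c : ℝ) (U V : Matrix (Fin p) (Fin q) ℝ) :
    frob (c • U) V = c * frob U V := by
  simp [frob]

theorem frob_transpose (U V : Matrix (Fin p) (Fin q) ℝ) : frob Uᵀ Vᵀ = frob U V := by
  simp only [frob_eq_sum, Matrix.transpose_apply]
  exact Finset.sum_comm

theorem frob_mul_left {r : ℕ} (U : Matrix (Fin p) (Fin r) ℝ) (V : Matrix (Fin r) (Fin q) ℝ)
    (X : Matrix (Fin p) (Fin q) ℝ) : frob (U * V) X = frob V (Uᵀ * X) := by
  simp [frob, Matrix.mul_assoc]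

theorem frob_mul_right {r : ℕ} (U : Matrix (Fin p) (Fin r) ℝ) (V : Matrix (Fin r) (Fin q) ℝ)
    (X : Matrix (Fin p) (Fin q) ℝ) : frob (U * V) X = frob U (X * Vᵀ) := by
  rw [frob, frob, Matrix.transpose_mul, Matrix.mul_assoc, Matrix.trace_mul_comm, Matrix.mul_assoc]

theorem frob_left_injective {U V : Matrix (Fin p) (Fin q) ℝ}
    (h : ∀ X, frob X U = frob X V) : U = V := by
  ext i j
  have := h (Matrix.single i j 1)
  simpa [frob_eq_sum, Matrix.single_apply, ite_and] using this

end frob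

theorem frob_lyapOp {n : ℕ} (τ : TimeModel) (F P X : Matrix (Fin n) (Fin n) ℝ) :
    frob (lyapOp τ F P) X = frob P (lyapOp τ Fᵀ X) := by
  cases τ
  · rw [lyapOp_ct, lyapOp_ct, frob_add_left, frob_add_right, frob_mul_left, frob_mul_right]
  · rw [lyapOp_dt, lyapOp_dt, frob_sub_left, frob_sub_right, frob_mul_left, frob_mul_right,
      Matrix.mul_assoc]

theorem tendsto_conj_pow {n : ℕ} {C : Matrix (Fin n) (Fin n) ℝ} (h : IsStable .dt C)
    (P : Matrix (Fin n) (Fin n) ℝ) :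
    Tendsto (fun k : ℕ => (C ^ k)ᵀ * (P * C ^ k)) atTop (𝓝 0) := by
  have h1 : Continuous fun M : Matrix (Fin n) (Fin n) ℝ => Mᵀ * (P * M) := by fun_prop
  have h2 := (h1.tendsto 0).comp h.tendsto_pow
  simpa [Function.comp_def] using h2

theorem conj_pow_succ {n : ℕ} (C P : Matrix (Fin n) (Fin n) ℝ) (k : ℕ) :
    (C ^ (k + 1))ᵀ * (P * C ^ (k + 1)) = (C ^ k)ᵀ * ((Cᵀ * (P * C)) * C ^ k) := by
  rw [pow_succ', Matrix.transpose_mul]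
  simp only [Matrix.mul_assoc]

theorem IsStable.eq_zero_of_lyapOp_dt {n : ℕ} {C P : Matrix (Fin n) (Fin n) ℝ}
    (h : IsStable .dt C) (hP : lyapOp .dt C P = 0) : P = 0 := by
  rw [lyapOp_dt, sub_eq_zero] at hP
  have h1 : ∀ k : ℕ, (C ^ k)ᵀ * (P * C ^ k) = P := by
    intro k
    induction k with
    | zero => simp
    | succ k ih => rw [conj_pow_succ, hP, ih]
  have h2 := tendsto_conj_pow h P
  simp only [h1] at h2
  exact tendsto_nhds_unique tendsto_const_nhds h2

/-- Telescoping writes P - (C ^ k)ᵀ P C ^ k as a sum of conjugates of -`lyapOp .dt C P`. The limit k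
→ ∞ stays in the closed cone, which also yields the symmetry of `P`. -/
theorem IsStable.posSemidef_of_lyapOp_dt {n : ℕ} {C P : Matrix (Fin n) (Fin n) ℝ}
    (h : IsStable .dt C) (hP : (-lyapOp .dt C P).PosSemidef) : P.PosSemidef := by
  have h1 : ∀ k : ℕ, (P - (C ^ k)ᵀ * (P * C ^ k)).PosSemidef := by
    intro k
    induction k with
    | zero => simpa using Matrix.PosSemidef.zero
    | succ k ih =>
      have h2 := ih.add (hP.conjTranspose_mul_mul_same (C ^ k))
      convert h2 using 1
      rw [conj_pow_succ, lyapOp_dt, Matrix.conjTranspose_eq_transpose_of_trivial]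
      noncomm_ring
  have h2 := tendsto_const_nhds.sub (tendsto_conj_pow h P) (a := P)
  rw [sub_zero] at h2
  exact (isClosed_setOf_posSemidef n).mem_of_tendsto h2 (Eventually.of_forall h1)

/-- The Cayley transform turns the continuous-time Lyapunov operator into the discrete-time one. -/
theorem lyapOp_dt_cayley {n : ℕ} {F C : Matrix (Fin n) (Fin n) ℝ} (hC : C * (1 - F) = 1 + F)
    (P : Matrix (Fin n) (Fin n) ℝ) :
    (1 - F)ᵀ * lyapOp .dt C P * (1 - F) = (2 : ℝ) • lyapOp .ct F P := by
  have hC' : (1 - F)ᵀ * Cᵀ = (1 + F)ᵀ := by rw [← Matrix.transpose_mul, hC]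
  have h1 : (1 - F)ᵀ * lyapOp .dt C P * (1 - F) =
      ((1 - F)ᵀ * Cᵀ) * P * (C * (1 - F)) - (1 - F)ᵀ * P * (1 - F) := by
    rw [lyapOp_dt]; noncomm_ring
  rw [h1, hC, hC', lyapOp_ct, Matrix.transpose_add, Matrix.transpose_sub, Matrix.transpose_one,
    two_smul]
  noncomm_ring

theorem IsStable.exists_cayley {n : ℕ} {F : Matrix (Fin n) (Fin n) ℝ} (h : IsStable .ct F) :
    ∃ C : Matrix (Fin n) (Fin n) ℝ, IsStable .dt C ∧ C * (1 - F) = 1 + F := by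
  have hu := h.isUnit_det_one_sub
  have h1 : (1 - F)⁻¹ * (1 + F) * (1 - F) = 1 + F := by
    have : (1 + F) * (1 - F) = (1 - F) * (1 + F) := by noncomm_ring
    rw [Matrix.mul_assoc, this, ← Matrix.mul_assoc, Matrix.nonsing_inv_mul _ hu, Matrix.one_mul]
  refine ⟨(1 - F)⁻¹ * (1 + F), h.cayley ?_, h1⟩
  rw [← Matrix.mul_assoc, Matrix.mul_nonsing_inv _ hu, Matrix.one_mul]

theorem IsStable.lyapOp_injective {n : ℕ} {τ : TimeModel} {F : Matrix (Fin n) (Fin n) ℝ}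
    (h : IsStable τ F) : Function.Injective (lyapOp τ F) := by
  rw [injective_iff_map_eq_zero]
  intro P hP
  cases τ
  · obtain ⟨C, hC, hCF⟩ := h.exists_cayley
    have hu := h.isUnit_det_one_sub
    refine hC.eq_zero_of_lyapOp_dt ?_
    have h1 := lyapOp_dt_cayley hCF P
    rw [hP, smul_zero] at h1
    have h2 := congrArg (fun M => (1 - F)ᵀ⁻¹ * M * (1 - F)⁻¹) h1
    have hu' : IsUnit (1 - F)ᵀ.det := by rwa [Matrix.det_transpose]
    rw [Matrix.transpose_sub, Matrix.transpose_one] at hu'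
    simpa [Matrix.mul_assoc, Matrix.mul_nonsing_inv _ hu,
      Matrix.nonsing_inv_mul_cancel_left _ _ hu'] using h2
  · exact h.eq_zero_of_lyapOp_dt hP

theorem IsStable.posSemidef_of_lyapOp {n : ℕ} {τ : TimeModel} {F P : Matrix (Fin n) (Fin n) ℝ}
    (h : IsStable τ F) (hP : (-lyapOp τ F P).PosSemidef) : P.PosSemidef := by
  cases τ
  · obtain ⟨C, hC, hCF⟩ := h.exists_cayley
    have hu := h.isUnit_det_one_sub
    refine hC.posSemidef_of_lyapOp_dt ?_
    have h1 := lyapOp_dt_cayley hCF P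
    have h3 : -lyapOp .dt C P = (1 - F)⁻¹ᴴ * ((2 : ℝ) • -lyapOp .ct F P) * (1 - F)⁻¹ := by
      have hu' : IsUnit (1 - F)ᵀ.det := by rwa [Matrix.det_transpose]
      rw [Matrix.transpose_sub, Matrix.transpose_one] at hu'
      rw [smul_neg, ← h1, Matrix.conjTranspose_eq_transpose_of_trivial,
        Matrix.transpose_nonsing_inv]
      simp [Matrix.mul_assoc, Matrix.mul_nonsing_inv _ hu,
        Matrix.nonsing_inv_mul_cancel_left _ _ hu']
    rw [h3]
    exact (hP.smul (by norm_num : (0 : ℝ) ≤ 2)).conjTranspose_mul_mul_same _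
  · exact h.posSemidef_of_lyapOp_dt hP

theorem IsStable.lyapOp_surjective {n : ℕ} {τ : TimeModel} {F : Matrix (Fin n) (Fin n) ℝ}
    (h : IsStable τ F) : Function.Surjective (lyapOp τ F) :=
  LinearMap.injective_iff_surjective.1 h.lyapOp_injective

/-- The adjoint of a surjective operator is injective. -/
theorem IsStable.lyapOp_transpose_injective {n : ℕ} {τ : TimeModel}
    {F : Matrix (Fin n) (Fin n) ℝ} (h : IsStable τ F) : Function.Injective (lyapOp τ Fᵀ) := by
  intro X Y hXY
  refine frob_left_injective fun M => ?_
  obtain ⟨P, rfl⟩ := h.lyapOp_surjective M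
  rw [frob_lyapOp, frob_lyapOp, hXY]

/-! ### Value residual and detectability -/

/-- The factor by which a quadratic Lyapunov function changes along an eigenvector with eigenvalue
`x + i y`. -/
def growthRate (τ : TimeModel) (x y : ℝ) : ℝ :=
  match τ with
  | .ct => 2 * x
  | .dt => x ^ 2 + y ^ 2 - 1

theorem isStable_iff {n : ℕ} (τ : TimeModel) (M : Matrix (Fin n) (Fin n) ℝ) :
    IsStable τ M ↔
      ∀ z ∈ spectrum ℂ (M.map (fun x : ℝ => (x : ℂ))), growthRate τ z.re z.im < 0 := by
  cases τ
  · exact forall₂_congr fun z _ => by rw [growthRate]; constructor <;> intro h <;> linarith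
  · rw [isStable_dt_iff]
    refine forall₂_congr fun z _ => ?_
    rw [growthRate, ← sq_lt_one_iff₀ (norm_nonneg z), Complex.sq_norm, Complex.normSq_apply,
      sub_neg, sq, sq]

/-- This is the Hermitian form of `lyapOp τ F P` at v = a + ib, an eigenvector of `F`; the cross
terms cancel by symmetry of `P`. -/
theorem lyapOp_quadratic_form {n : ℕ} (τ : TimeModel) {F P : Matrix (Fin n) (Fin n) ℝ}
    (hP : P.IsSymm) {x y : ℝ} {a b : Fin n → ℝ} (ha : F *ᵥ a = x • a - y • b)
    (hb : F *ᵥ b = y • a + x • b) :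
    a ⬝ᵥ lyapOp τ F P *ᵥ a + b ⬝ᵥ lyapOp τ F P *ᵥ b =
      growthRate τ x y * (a ⬝ᵥ P *ᵥ a + b ⬝ᵥ P *ᵥ b) := by
  have hab : b ⬝ᵥ P *ᵥ a = a ⬝ᵥ P *ᵥ b := by
    rw [Matrix.dotProduct_mulVec, ← Matrix.mulVec_transpose, hP.eq, dotProduct_comm]
  have ht : ∀ u v : Fin n → ℝ, u ⬝ᵥ Fᵀ *ᵥ v = (F *ᵥ u) ⬝ᵥ v := fun u v => by
    rw [Matrix.dotProduct_mulVec, Matrix.vecMul_transpose]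
  cases τ
  · simp only [lyapOp_ct, Matrix.add_mulVec, ← Matrix.mulVec_mulVec, dotProduct_add, ht, ha, hb,
      Matrix.mulVec_add, Matrix.mulVec_sub, Matrix.mulVec_smul, dotProduct_sub, dotProduct_smul,
      add_dotProduct, sub_dotProduct, smul_dotProduct, hab, smul_eq_mul, growthRate]
    ring
  · simp only [lyapOp_dt, Matrix.sub_mulVec, ← Matrix.mulVec_mulVec, dotProduct_add, ht, ha, hb,
      Matrix.mulVec_add, Matrix.mulVec_sub, Matrix.mulVec_smul, dotProduct_sub, dotProduct_smul,
      add_dotProduct, sub_dotProduct, smul_dotProduct, hab, smul_eq_mul, growthRate]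
    ring

/-- The residual `L_{A + B K}(P) + Q + Kᵀ R K` of the value equation of the gain `K`. -/
def valueResidual {n m : ℕ} (τ : TimeModel) (A : Matrix (Fin n) (Fin n) ℝ)
    (B : Matrix (Fin n) (Fin m) ℝ) (Q : Matrix (Fin n) (Fin n) ℝ) (R : Matrix (Fin m) (Fin m) ℝ)
    (P : Matrix (Fin n) (Fin n) ℝ) (K : Matrix (Fin m) (Fin n) ℝ) : Matrix (Fin n) (Fin n) ℝ :=
  lyapOp τ (A + B * K) P + (Q + Kᵀ * R * K)

/-- The quadratic coefficient in `K` of `valueResidual`. -/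
def inputWeight {n m : ℕ} (τ : TimeModel) (B : Matrix (Fin n) (Fin m) ℝ)
    (R : Matrix (Fin m) (Fin m) ℝ) (P : Matrix (Fin n) (Fin n) ℝ) : Matrix (Fin m) (Fin m) ℝ :=
  match τ with
  | .ct => R
  | .dt => R + Bᵀ * P * B

/-- The linear coefficient in `K` of `valueResidual`. -/
def crossWeight {n m : ℕ} (τ : TimeModel) (A : Matrix (Fin n) (Fin n) ℝ)
    (B : Matrix (Fin n) (Fin m) ℝ) (P : Matrix (Fin n) (Fin n) ℝ) : Matrix (Fin m) (Fin n) ℝ :=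
  match τ with
  | .ct => Bᵀ * P
  | .dt => Bᵀ * P * A

section

variable {n m : ℕ} {τ : TimeModel} {A : Matrix (Fin n) (Fin n) ℝ} {B : Matrix (Fin n) (Fin m) ℝ}
  {Q : Matrix (Fin n) (Fin n) ℝ} {R : Matrix (Fin m) (Fin m) ℝ} {P : Matrix (Fin n) (Fin n) ℝ}

theorem valueResidual_expand (hR : R.IsSymm) (hP : P.IsSymm) (K K' : Matrix (Fin m) (Fin n) ℝ) :
    valueResidual τ A B Q R P K' = valueResidual τ A B Q R P K +
      ((K' - K)ᵀ * (crossWeight τ A B P + inputWeight τ B R P * K) +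
        (crossWeight τ A B P + inputWeight τ B R P * K)ᵀ * (K' - K) +
        (K' - K)ᵀ * inputWeight τ B R P * (K' - K)) := by
  cases τ
  · simp only [valueResidual, crossWeight, inputWeight, lyapOp_ct, Matrix.transpose_add,
      Matrix.transpose_mul, Matrix.transpose_sub, Matrix.transpose_transpose, hR.eq, hP.eq,
      Matrix.mul_add, Matrix.add_mul, Matrix.mul_sub, Matrix.sub_mul, Matrix.mul_assoc]
    abel
  · simp only [valueResidual, crossWeight, inputWeight, lyapOp_dt, Matrix.transpose_add,
      Matrix.transpose_mul, Matrix.transpose_sub, Matrix.transpose_transpose, hR.eq, hP.eq,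
      Matrix.mul_add, Matrix.add_mul, Matrix.mul_sub, Matrix.sub_mul, Matrix.mul_assoc]
    abel

theorem inputWeight_sub_posSemidef (hP : P.PosSemidef) : (inputWeight τ B R P - R).PosSemidef := by
  cases τ
  · simpa [inputWeight] using Matrix.PosSemidef.zero
  · simpa [inputWeight] using hP.conjTranspose_mul_mul_same B

theorem inputWeight_posDef (hR : R.PosDef) (hP : P.PosSemidef) :
    (inputWeight τ B R P).PosDef := by
  simpa using hR.add_posSemidef (inputWeight_sub_posSemidef (τ := τ) (B := B) (R := R) hP)

theorem _root_.Matrix.PosSemidef.isSymm {k : ℕ} {M : Matrix (Fin k) (Fin k) ℝ}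
    (hM : M.PosSemidef) : M.IsSymm := hM.isHermitian

theorem transpose_mul_mul_posSemidef {p q : ℕ} {M : Matrix (Fin p) (Fin p) ℝ} (hM : M.PosSemidef)
    (K : Matrix (Fin p) (Fin q) ℝ) : (Kᵀ * M * K).PosSemidef :=
  hM.conjTranspose_mul_mul_same K

theorem dotProduct_conj_mulVec {p q : ℕ} (M : Matrix (Fin p) (Fin p) ℝ)
    (K : Matrix (Fin p) (Fin q) ℝ) (a : Fin q → ℝ) :
    a ⬝ᵥ (Kᵀ * M * K) *ᵥ a = (K *ᵥ a) ⬝ᵥ M *ᵥ (K *ᵥ a) := by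
  rw [Matrix.mul_assoc, ← Matrix.mulVec_mulVec, Matrix.dotProduct_mulVec, Matrix.vecMul_transpose,
    Matrix.mulVec_mulVec]

theorem sqrt_mulVec_eq_zero (hQ : Q.PosSemidef) {a : Fin n → ℝ} (ha : a ⬝ᵥ Q *ᵥ a = 0) :
    CFC.sqrt Q *ᵥ a = 0 := by
  have h1 : CFC.sqrt Q * CFC.sqrt Q = Q := CFC.sqrt_mul_sqrt_self Q hQ.nonneg
  have h2 : (CFC.sqrt Q).PosSemidef := Matrix.nonneg_iff_posSemidef.1 (CFC.sqrt_nonneg Q)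
  have h3 : (CFC.sqrt Q)ᵀ = CFC.sqrt Q := h2.isHermitian
  have h4 := dotProduct_conj_mulVec 1 (CFC.sqrt Q) a
  rw [h3, Matrix.mul_one, h1, ha, Matrix.one_mulVec] at h4
  exact dotProduct_self_eq_zero.1 h4.symm

/-- A positive semidefinite storage function for a detectable system certifies stability. -/
theorem isStable_of_valueResidual (hQ : Q.PosSemidef) (hR : R.PosDef)
    (hdet : IsDetectable τ (CFC.sqrt Q) A) (hP : P.PosSemidef) {K : Matrix (Fin m) (Fin n) ℝ}
    (h : (-valueResidual τ A B Q R P K).PosSemidef) : IsStable τ (A + B * K) := by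
  obtain ⟨L, hL⟩ := hdet
  rw [isStable_iff] at hL ⊢
  intro z hz
  by_contra! hg
  obtain ⟨a, b, hab, ha, hb⟩ := (mem_spectrum_map_iff _ _).1 hz
  have hquad := lyapOp_quadratic_form τ (P := P) hP.isHermitian ha hb
  have hnn : ∀ {k : ℕ} {M : Matrix (Fin k) (Fin k) ℝ}, M.PosSemidef → ∀ v, 0 ≤ v ⬝ᵥ M *ᵥ v :=
    fun hM v => by simpa using hM.dotProduct_mulVec_nonneg v
  have hGa := hnn h a
  have hGb := hnn h b
  simp only [valueResidual, Matrix.neg_mulVec, Matrix.add_mulVec, dotProduct_neg, dotProduct_add,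
    dotProduct_conj_mulVec] at hGa hGb
  have hp := mul_nonneg hg (add_nonneg (hnn hP a) (hnn hP b))
  have hQa := hnn hQ a
  have hQb := hnn hQ b
  have hRa := hnn hR.posSemidef (K *ᵥ a)
  have hRb := hnn hR.posSemidef (K *ᵥ b)
  -- The growth, Q and R terms are nonnegative with sum at most 0, so each vanishes.
  have hSa := sqrt_mulVec_eq_zero hQ (a := a) (by linarith)
  have hSb := sqrt_mulVec_eq_zero hQ (a := b) (by linarith)
  have hK : ∀ v, (K *ᵥ v) ⬝ᵥ R *ᵥ (K *ᵥ v) = 0 → K *ᵥ v = 0 := fun v hv => by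
    by_contra hv0
    have := hR.dotProduct_mulVec_pos hv0
    rw [star_trivial, hv] at this
    exact lt_irrefl _ this
  have hKa := hK a (by linarith)
  have hKb := hK b (by linarith)
  -- `K` and `CFC.sqrt Q` kill `a` and `b`, so A + BK and A + L√Q agree there and share the
  -- eigenvalue `z`.
  refine absurd (hL z ((mem_spectrum_map_iff _ _).2 ⟨a, b, hab, ?_, ?_⟩)) (not_lt.2 hg)
  · rw [← ha]
    simp only [Matrix.add_mulVec, ← Matrix.mulVec_mulVec, hSa, hKa, Matrix.mulVec_zero]
  · rw [← hb]
    simp only [Matrix.add_mulVec, ← Matrix.mulVec_mulVec, hSb, hKb, Matrix.mulVec_zero]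

theorem exists_valueResidual_eq_zero (hQ : Q.PosSemidef) (hR : R.PosDef)
    {K : Matrix (Fin m) (Fin n) ℝ} (hK : IsStable τ (A + B * K)) :
    ∃ P : Matrix (Fin n) (Fin n) ℝ, P.PosSemidef ∧ valueResidual τ A B Q R P K = 0 := by
  obtain ⟨P, hP⟩ := hK.lyapOp_surjective (-(Q + Kᵀ * R * K))
  refine ⟨P, hK.posSemidef_of_lyapOp ?_, by rw [valueResidual, hP, neg_add_cancel]⟩
  rw [hP, neg_neg]
  exact hQ.add (transpose_mul_mul_posSemidef hR.posSemidef K)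

/-! ### The Riccati equation by trace minimization -/

/-- Testing on e_i ± e_j gives 2|P i j| ≤ P i i + P j j. -/
theorem abs_apply_le_trace (hP : P.PosSemidef) (i j : Fin n) : |P i j| ≤ P.trace := by
  have hd : ∀ k, 0 ≤ P k k := fun k => hP.diag_nonneg
  have hs : P j i = P i j := congrFun (congrFun hP.isHermitian i) j
  have hle : ∀ k, P k k ≤ P.trace := fun k =>
    Finset.single_le_sum (f := fun k => P k k) (fun k _ => hd k) (Finset.mem_univ k)
  have h1 := hP.dotProduct_mulVec_nonneg (Pi.single i 1 + Pi.single j 1)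
  have h2 := hP.dotProduct_mulVec_nonneg (Pi.single i 1 - Pi.single j 1)
  simp [Matrix.mulVec_add, Matrix.mulVec_sub] at h1 h2
  rw [abs_le]
  constructor <;> linarith [hle i, hle j]

theorem isCompact_posSemidef_trace_le (n : ℕ) (c : ℝ) :
    IsCompact {P : Matrix (Fin n) (Fin n) ℝ | P.PosSemidef ∧ P.trace ≤ c} := by
  have h1 : IsCompact (Set.univ.pi fun _ : Fin n => Set.univ.pi fun _ : Fin n => Set.Icc (-c) c) :=
    isCompact_univ_pi fun _ => isCompact_univ_pi fun _ => isCompact_Icc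
  refine IsCompact.of_isClosed_subset (X := Matrix (Fin n) (Fin n) ℝ) h1 ?_ ?_
  · exact (isClosed_setOf_posSemidef n).inter (isClosed_le continuous_id.matrix_trace continuous_const)
  · rintro P ⟨hP, hc⟩ i - j -
    exact abs_le.1 ((abs_apply_le_trace hP i j).trans hc)

/-- The stationary gain `-R̃(P)⁻¹ N(P)`. -/
noncomputable def greedyGain (τ : TimeModel) (A : Matrix (Fin n) (Fin n) ℝ) (B : Matrix (Fin n) (Fin m) ℝ)
    (R : Matrix (Fin m) (Fin m) ℝ) (P : Matrix (Fin n) (Fin n) ℝ) : Matrix (Fin m) (Fin n) ℝ :=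
  -((inputWeight τ B R P)⁻¹ * crossWeight τ A B P)

theorem crossWeight_add_greedyGain (hR : R.PosDef) (hP : P.PosSemidef) :
    crossWeight τ A B P + inputWeight τ B R P * greedyGain τ A B R P = 0 := by
  have h := (Matrix.isUnit_iff_isUnit_det _).1 (inputWeight_posDef (τ := τ) (B := B) hR hP).isUnit
  rw [greedyGain, Matrix.mul_neg, Matrix.mul_nonsing_inv_cancel_left _ _ h, add_neg_cancel]

theorem continuousAt_greedyGain (hR : R.PosDef) (hP : P.PosSemidef) :
    ContinuousAt (greedyGain τ A B R) P := by
  have h := (Matrix.isUnit_iff_isUnit_det _).1 (inputWeight_posDef (τ := τ) (B := B) hR hP).isUnit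
  have h1 : Continuous (inputWeight τ B R) := by
    cases τ
    · exact continuous_const
    · unfold inputWeight; fun_prop
  have h2 : Continuous (crossWeight τ A B) := by
    cases τ <;> unfold crossWeight <;> fun_prop
  have h3 : ContinuousAt Ring.inverse (inputWeight τ B R P).det := by
    rw [show (Ring.inverse : ℝ → ℝ) = Inv.inv from Ring.inverse_eq_inv']
    exact continuousAt_inv₀ h.ne_zero
  have h4 : ContinuousAt (fun X => (inputWeight τ B R X)⁻¹) P :=
    (continuousAt_matrix_inv _ h3).comp_of_eq h1.continuousAt rfl
  have h5 : Continuous fun p : Matrix (Fin m) (Fin m) ℝ × Matrix (Fin m) (Fin n) ℝ =>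
      -(p.1 * p.2) := by fun_prop
  exact h5.continuousAt.comp_of_eq (h4.prodMk h2.continuousAt) rfl

theorem continuous_valueResidual :
    Continuous fun p : Matrix (Fin n) (Fin n) ℝ × Matrix (Fin m) (Fin n) ℝ =>
      valueResidual τ A B Q R p.1 p.2 := by
  unfold valueResidual
  refine Continuous.add ?_ (by fun_prop)
  exact (continuous_lyapOp τ).comp
    (f := fun p : Matrix (Fin n) (Fin n) ℝ × Matrix (Fin m) (Fin n) ℝ => (A + B * p.2, p.1))
    (by fun_prop)

/-- Policy improvement: the expansion around the greedy gain has no linear term, so the residual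
there is 0 minus a positive semidefinite square. -/
theorem valueResidual_greedyGain_posSemidef (hR : R.PosDef) (hP : P.PosSemidef)
    {K : Matrix (Fin m) (Fin n) ℝ} (h : valueResidual τ A B Q R P K = 0) :
    (-valueResidual τ A B Q R P (greedyGain τ A B R P)).PosSemidef := by
  have h1 := valueResidual_expand (τ := τ) (A := A) (B := B) (Q := Q) hR.posSemidef.isSymm
    hP.isSymm (greedyGain τ A B R P) K
  rw [h, crossWeight_add_greedyGain hR hP] at h1
  simp only [Matrix.mul_zero, Matrix.transpose_zero, Matrix.zero_mul, zero_add] at h1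
  rw [neg_eq_iff_add_eq_zero.2 h1.symm]
  exact transpose_mul_mul_posSemidef (inputWeight_posDef hR hP).posSemidef _

/-- The algebraic Riccati equation of a stabilizable and detectable problem has a positive
semidefinite stabilizing solution. -/
theorem exists_riccati_solution (hQ : Q.PosSemidef) (hR : R.PosDef) (hstab : IsStabilizable τ A B)
    (hdet : IsDetectable τ (CFC.sqrt Q) A) :
    ∃ (P : Matrix (Fin n) (Fin n) ℝ) (K : Matrix (Fin m) (Fin n) ℝ), P.PosSemidef ∧
      IsStable τ (A + B * K) ∧ valueResidual τ A B Q R P K = 0 ∧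
      crossWeight τ A B P + inputWeight τ B R P * K = 0 := by
  obtain ⟨K₀, hK₀⟩ := hstab
  obtain ⟨P₀, hP₀, hV₀⟩ := exists_valueResidual_eq_zero hQ hR hK₀
  -- The trace is minimized over those P ⪰ 0 whose residual at their greedy gain is ⪯ 0; the bound
  -- by the trace of `P₀` provides compactness.
  set S : Set (Matrix (Fin n) (Fin n) ℝ) := {P | P.PosSemidef ∧ P.trace ≤ P₀.trace}
  set g : Matrix (Fin n) (Fin n) ℝ → Matrix (Fin n) (Fin n) ℝ :=
    fun P => -valueResidual τ A B Q R P (greedyGain τ A B R P)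
  have hS : IsCompact S := isCompact_posSemidef_trace_le n _
  have hg : ContinuousOn g S := fun P hP => by
    refine ContinuousAt.continuousWithinAt ?_
    exact (continuous_valueResidual.continuousAt.comp_of_eq
      (f := fun P => (P, greedyGain τ A B R P))
      (continuousAt_id.prodMk (continuousAt_greedyGain hR hP.1)) rfl).neg
  have hT : IsCompact (S ∩ g ⁻¹' {M | M.PosSemidef}) :=
    hS.of_isClosed_subset (hg.preimage_isClosed_of_isClosed hS.isClosed
      (isClosed_setOf_posSemidef n)) Set.inter_subset_left
  obtain ⟨P, ⟨⟨hP, htr⟩, hgP⟩, hmin⟩ := hT.exists_isMinOn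
    ⟨P₀, ⟨hP₀, le_rfl⟩, valueResidual_greedyGain_posSemidef hR hP₀ hV₀⟩
    (f := fun P : Matrix (Fin n) (Fin n) ℝ => P.trace) (by fun_prop)
  set K := greedyGain τ A B R P with hKdef
  have hK : IsStable τ (A + B * K) := isStable_of_valueResidual hQ hR hdet hP hgP
  obtain ⟨P', hP', hV'⟩ := exists_valueResidual_eq_zero hQ hR hK
  have hsub : (P - P').PosSemidef := by
    refine hK.posSemidef_of_lyapOp ?_
    have : lyapOp τ (A + B * K) (P - P') = valueResidual τ A B Q R P K := by
      rw [← sub_zero (valueResidual τ A B Q R P K), ← hV', valueResidual, valueResidual, map_sub]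
      abel
    rw [this]
    exact hgP
  have h1 := hsub.trace_nonneg
  rw [Matrix.trace_sub] at h1
  -- The value matrix of the greedy gain lies below the minimizer and is again admissible, so the
  -- two coincide.
  have h2 : P.trace ≤ P'.trace := hmin ⟨⟨hP', by linarith⟩,
    valueResidual_greedyGain_posSemidef hR hP' hV'⟩
  have h3 : (P - P').trace = 0 := by rw [Matrix.trace_sub]; linarith
  have h4 : P - P' = 0 := hsub.trace_eq_zero_iff.1 h3
  rw [← sub_eq_zero.1 h4] at hV'
  exact ⟨P, K, hP, hK, hV', crossWeight_add_greedyGain hR hP⟩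

end

/-! ### Differentiation against the Frobenius pairing -/

/-- Pairing with a fixed matrix, as a continuous linear functional. -/
noncomputable def frobCLM {p q : ℕ} (U : Matrix (Fin p) (Fin q) ℝ) :
    Matrix (Fin p) (Fin q) ℝ →L[ℝ] ℝ where
  toFun := frob U
  map_add' := frob_add_right U
  map_smul' c V := by simp [frob]
  cont := by
    change Continuous fun V : Matrix (Fin p) (Fin q) ℝ => (Uᵀ * V).trace
    fun_prop

theorem frobCLM_apply {p q : ℕ} (U V : Matrix (Fin p) (Fin q) ℝ) : frobCLM U V = frob U V := rfl

section Norm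

attribute [local instance] Matrix.normedAddCommGroup Matrix.normedSpace

theorem abs_frob_le {p q : ℕ} (U V : Matrix (Fin p) (Fin q) ℝ) :
    |frob U V| ≤ (∑ i, ∑ j, |U i j|) * ‖V‖ := by
  rw [frob_eq_sum, Finset.sum_mul]
  refine (Finset.abs_sum_le_sum_abs _ _).trans (Finset.sum_le_sum fun i _ => ?_)
  rw [Finset.sum_mul]
  refine (Finset.abs_sum_le_sum_abs _ _).trans (Finset.sum_le_sum fun j _ => ?_)
  rw [abs_mul]
  exact mul_le_mul_of_nonneg_left (Matrix.norm_entry_le_entrywise_sup_norm V) (abs_nonneg _)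

/-- Carathéodory's criterion for differentiability, with slopes expressed by `frob`. -/
theorem hasFDerivAt_of_eventually_eq_frob {p q : ℕ} {f : Matrix (Fin p) (Fin q) ℝ → ℝ}
    {c : Matrix (Fin p) (Fin q) ℝ → Matrix (Fin p) (Fin q) ℝ} {K : Matrix (Fin p) (Fin q) ℝ}
    (hc : ContinuousAt c K) (h : ∀ᶠ K' in 𝓝 K, f K' = f K + frob (c K') (K' - K)) :
    HasFDerivAt f (frobCLM (c K)) K := by
  refine HasFDerivAt.of_isLittleO (Asymptotics.isLittleO_iff.2 ?_)
  intro ε hε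
  have h1 : ContinuousAt (fun K' => ∑ i, ∑ j, |(c K' - c K) i j|) K := by
    have : Continuous fun M : Matrix (Fin p) (Fin q) ℝ => ∑ i, ∑ j, |(M - c K) i j| := by
      fun_prop
    exact this.continuousAt.comp_of_eq hc rfl
  have h2 : ∀ᶠ K' in 𝓝 K, ∑ i, ∑ j, |(c K' - c K) i j| < ε :=
    h1.eventually_lt continuousAt_const (by simpa using hε)
  filter_upwards [h, h2] with K' hK' hε'
  rw [hK']
  change ‖f K + frob (c K') (K' - K) - f K - frob (c K) (K' - K)‖ ≤ _
  rw [add_sub_cancel_left, ← frob_sub_left, Real.norm_eq_abs]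
  exact (abs_frob_le _ _).trans (mul_le_mul_of_nonneg_right hε'.le (norm_nonneg _))

end Norm

theorem matrixGradient_eq {p q : ℕ} {f : Matrix (Fin p) (Fin q) ℝ → ℝ}
    {G K : Matrix (Fin p) (Fin q) ℝ} (h : HasFDerivAt f (frobCLM G) K) :
    matrixGradient f K = G := by
  ext i j
  rw [matrixGradient, Matrix.of_apply, h.fderiv, frobCLM_apply, frob_eq_sum]
  simp [Matrix.single_apply, ite_and]

/-! ### Continuous dependence of solutions of linear equations -/

section LinearFamily

variable {Y V ι : Type*} [TopologicalSpace Y] [AddCommGroup V] [Module ℝ V] [Fintype ι]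
  [DecidableEq ι] {L : Y → V →ₗ[ℝ] V} {y₀ : Y}

theorem _root_.LinearMap.injective_iff_det_toMatrix_ne_zero (b : Module.Basis ι ℝ V)
    (T : V →ₗ[ℝ] V) : Function.Injective T ↔ (LinearMap.toMatrix b b T).det ≠ 0 := by
  have : FiniteDimensional ℝ V := b.finiteDimensional_of_finite
  rw [LinearMap.det_toMatrix, ← isUnit_iff_ne_zero, ← LinearMap.isUnit_iff_isUnit_det,
    LinearMap.isUnit_iff_ker_eq_bot, LinearMap.ker_eq_bot]

theorem eventually_injective_of_continuousAt (b : Module.Basis ι ℝ V)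
    (hL : ∀ i j, ContinuousAt (fun y => b.repr (L y (b j)) i) y₀)
    (h : Function.Injective (L y₀)) : ∀ᶠ y in 𝓝 y₀, Function.Injective (L y) := by
  have h1 : ContinuousAt (fun y => LinearMap.toMatrix b b (L y)) y₀ :=
    continuousAt_pi.2 fun i => continuousAt_pi.2 fun j => by
      simpa only [LinearMap.toMatrix_apply] using hL i j
  have h2 : ContinuousAt (fun y => (LinearMap.toMatrix b b (L y)).det) y₀ :=
    continuous_id.matrix_det.continuousAt.comp_of_eq h1 rfl
  filter_upwards [h2.eventually_ne ((LinearMap.injective_iff_det_toMatrix_ne_zero b _).1 h)]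
    with y hy
  exact (LinearMap.injective_iff_det_toMatrix_ne_zero b _).2 hy

/-- Near `y₀` the coordinates of `x y` are the inverse matrix of `L y` applied to those of `w`. -/
theorem continuousAt_repr_of_injective (b : Module.Basis ι ℝ V)
    (hL : ∀ i j, ContinuousAt (fun y => b.repr (L y (b j)) i) y₀)
    (h : Function.Injective (L y₀)) {x : Y → V} {w : V} (hx : ∀ᶠ y in 𝓝 y₀, L y (x y) = w)
    (i : ι) : ContinuousAt (fun y => b.repr (x y) i) y₀ := by
  have h1 : ContinuousAt (fun y => LinearMap.toMatrix b b (L y)) y₀ :=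
    continuousAt_pi.2 fun i => continuousAt_pi.2 fun j => by
      simpa only [LinearMap.toMatrix_apply] using hL i j
  have hdet := (LinearMap.injective_iff_det_toMatrix_ne_zero b _).1 h
  have h3 : ContinuousAt Ring.inverse (LinearMap.toMatrix b b (L y₀)).det := by
    rw [show (Ring.inverse : ℝ → ℝ) = Inv.inv from Ring.inverse_eq_inv']
    exact continuousAt_inv₀ hdet
  have h4 : ContinuousAt (fun y => (LinearMap.toMatrix b b (L y))⁻¹) y₀ :=
    (continuousAt_matrix_inv _ h3).comp_of_eq h1 rfl
  have h5 : Continuous fun M : Matrix ι ι ℝ => (M *ᵥ b.repr w) i := by fun_prop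
  refine (h5.continuousAt.comp_of_eq h4 rfl).congr ?_
  filter_upwards [hx, eventually_injective_of_continuousAt b hL h] with y hy hinj
  have hu := (isUnit_iff_ne_zero.2 ((LinearMap.injective_iff_det_toMatrix_ne_zero b _).1 hinj))
  have h6 := LinearMap.toMatrix_mulVec_repr b b (L y) (x y)
  simp only [Function.comp_apply]
  rw [← hy, ← h6, Matrix.mulVec_mulVec, Matrix.nonsing_inv_mul _ hu, Matrix.one_mulVec]

end LinearFamily

/-! ### Performance difference and gradient of the cost -/

section

variable {n m : ℕ} {τ : TimeModel} {A : Matrix (Fin n) (Fin n) ℝ} {B : Matrix (Fin n) (Fin m) ℝ}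
  {Q : Matrix (Fin n) (Fin n) ℝ} {R : Matrix (Fin m) (Fin m) ℝ} {W : Matrix (Fin n) (Fin n) ℝ}
  {K : Matrix (Fin m) (Fin n) ℝ}

theorem existsUnique_isLyapunovSolution (hW : W.IsSymm)
    (h : Function.Injective (lyapOp τ (A + B * K)ᵀ)) :
    ∃! X, IsLyapunovSolution τ A B W K X := by
  obtain ⟨X, hX⟩ := LinearMap.injective_iff_surjective.1 h (-W)
  refine ⟨X, (isLyapunovSolution_iff ..).2 ⟨h ?_, hX⟩, fun Y hY => h ?_⟩
  · rw [← transpose_lyapOp, hX, Matrix.transpose_neg, hW.eq]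
  · rw [((isLyapunovSolution_iff ..).1 hY).2, hX]

theorem isLyapunovSolution_lyapunovVar (h : ∃ X, IsLyapunovSolution τ A B W K X) :
    IsLyapunovSolution τ A B W K (lyapunovVar τ A B W K) := by
  rw [lyapunovVar, dif_pos h]
  exact h.choose_spec

theorem continuousAt_lyapOp_repr (i j : Fin n × Fin n) :
    ContinuousAt (fun K : Matrix (Fin m) (Fin n) ℝ =>
      (Matrix.stdBasis ℝ (Fin n) (Fin n)).repr
        (lyapOp τ (A + B * K)ᵀ (Matrix.stdBasis ℝ (Fin n) (Fin n) j)) i) K := by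
  have h1 : Continuous fun K : Matrix (Fin m) (Fin n) ℝ =>
      lyapOp τ (A + B * K)ᵀ (Matrix.stdBasis ℝ (Fin n) (Fin n) j) :=
    (continuous_lyapOp τ).comp (f := fun K : Matrix (Fin m) (Fin n) ℝ =>
      ((A + B * K)ᵀ, Matrix.stdBasis ℝ (Fin n) (Fin n) j)) (by fun_prop)
  exact (h1.matrix_elem i.1 i.2).continuousAt

/-- Injectivity is an open condition, so near `K` the default value 0 of `lyapunovVar` plays no
role; openness of the set of stabilizing gains is not needed. -/
theorem eventually_isLyapunovSolution (hW : W.IsSymm)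
    (h : Function.Injective (lyapOp τ (A + B * K)ᵀ)) :
    ∀ᶠ K' in 𝓝 K, IsLyapunovSolution τ A B W K' (lyapunovVar τ A B W K') := by
  filter_upwards [eventually_injective_of_continuousAt (L := fun K' => lyapOp τ (A + B * K')ᵀ)
    (Matrix.stdBasis ℝ (Fin n) (Fin n)) continuousAt_lyapOp_repr h] with K' hK'
  exact isLyapunovSolution_lyapunovVar (existsUnique_isLyapunovSolution hW hK').exists

theorem continuousAt_lyapunovVar (hW : W.IsSymm)
    (h : Function.Injective (lyapOp τ (A + B * K)ᵀ)) :
    ContinuousAt (lyapunovVar τ A B W) K :=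
  continuousAt_pi.2 fun i => continuousAt_pi.2 fun j =>
    continuousAt_repr_of_injective (L := fun K' => lyapOp τ (A + B * K')ᵀ)
      (Matrix.stdBasis ℝ (Fin n) (Fin n)) continuousAt_lyapOp_repr h (w := -W)
      ((eventually_isLyapunovSolution hW h).mono fun _ hK' =>
        ((isLyapunovSolution_iff ..).1 hK').2) (i, j)

theorem frob_stageCost_eq {X : Matrix (Fin n) (Fin n) ℝ} (hX : IsLyapunovSolution τ A B W K X)
    (P : Matrix (Fin n) (Fin n) ℝ) :
    frob (Q + Kᵀ * R * K) X = frob P W + frob (valueResidual τ A B Q R P K) X := by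
  rw [valueResidual, frob_add_left (lyapOp τ _ P), frob_lyapOp, ((isLyapunovSolution_iff ..).1 hX).2,
    frob_neg_right]
  ring

theorem frob_cross_add_quadratic {X : Matrix (Fin n) (Fin n) ℝ} (hX : X.IsSymm)
    (D E : Matrix (Fin m) (Fin n) ℝ) (S : Matrix (Fin m) (Fin m) ℝ) :
    frob (Dᵀ * E + Eᵀ * D + Dᵀ * S * D) X = 2 * frob (E * X) D + frob S (D * X * Dᵀ) := by
  have h1 : frob (Dᵀ * E) X = frob (E * X) D := by
    rw [frob_mul_left, frob_mul_right, hX.eq, Matrix.transpose_transpose]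
  have h2 : frob (Eᵀ * D) X = frob (E * X) D := by
    rw [← h1, ← frob_transpose, Matrix.transpose_mul, Matrix.transpose_transpose, hX.eq]
  have h3 : frob (Dᵀ * S * D) X = frob S (D * X * Dᵀ) := by
    rw [frob_mul_right, frob_mul_left, Matrix.transpose_transpose, Matrix.mul_assoc]
  rw [frob_add_left, frob_add_left, h1, h2, h3]
  ring

/-- The performance difference formula. -/
theorem cost_sub_cost (hR : R.IsSymm) {P : Matrix (Fin n) (Fin n) ℝ} (hP : P.IsSymm)
    (hPK : valueResidual τ A B Q R P K = 0)
    (hK : IsLyapunovSolution τ A B W K (lyapunovVar τ A B W K)) {K' : Matrix (Fin m) (Fin n) ℝ}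
    (hK' : IsLyapunovSolution τ A B W K' (lyapunovVar τ A B W K')) :
    cost τ A B Q R W K' - cost τ A B Q R W K =
      2 * frob ((crossWeight τ A B P + inputWeight τ B R P * K) * lyapunovVar τ A B W K')
          (K' - K) +
        frob (inputWeight τ B R P) ((K' - K) * lyapunovVar τ A B W K' * (K' - K)ᵀ) := by
  rw [cost, cost, frob_stageCost_eq hK P, frob_stageCost_eq hK' P, hPK,
    valueResidual_expand hR hP K K', hPK, zero_add, frob_cross_add_quadratic hK'.1]
  simp [frob]

/-- The performance difference has the form ⟨c(K'), K' - K⟩ with c continuous at `K`, so continuity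
of `lyapunovVar` suffices and its derivative never appears. -/
theorem hasFDerivAt_cost (hR : R.IsSymm) (hW : W.IsSymm) {P : Matrix (Fin n) (Fin n) ℝ}
    (hP : P.IsSymm) (hPK : valueResidual τ A B Q R P K = 0)
    (h : Function.Injective (lyapOp τ (A + B * K)ᵀ)) :
    HasFDerivAt (cost τ A B Q R W) (frobCLM ((2 : ℝ) •
      ((crossWeight τ A B P + inputWeight τ B R P * K) * lyapunovVar τ A B W K))) K := by
  have hX := continuousAt_lyapunovVar hW h
  obtain ⟨E, hE⟩ : ∃ E, E = crossWeight τ A B P + inputWeight τ B R P * K := ⟨_, rfl⟩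
  obtain ⟨S, hS⟩ : ∃ S, S = inputWeight τ B R P := ⟨_, rfl⟩
  have h1 : Continuous fun p : Matrix (Fin n) (Fin n) ℝ × Matrix (Fin m) (Fin n) ℝ =>
      (2 : ℝ) • (E * p.1) + S * ((p.2 - K) * p.1ᵀ) := by fun_prop
  have h2 : ContinuousAt (fun K' => (2 : ℝ) • (E * lyapunovVar τ A B W K') +
      S * ((K' - K) * (lyapunovVar τ A B W K')ᵀ)) K :=
    h1.continuousAt.comp_of_eq (f := fun K' => (lyapunovVar τ A B W K', K'))
      (hX.prodMk continuousAt_id) rfl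
  have hK := isLyapunovSolution_lyapunovVar (existsUnique_isLyapunovSolution hW h).exists
  have h3 : ∀ᶠ K' in 𝓝 K, cost τ A B Q R W K' = cost τ A B Q R W K +
      frob ((2 : ℝ) • (E * lyapunovVar τ A B W K') +
        S * ((K' - K) * (lyapunovVar τ A B W K')ᵀ)) (K' - K) := by
    filter_upwards [eventually_isLyapunovSolution hW h] with K' hK'
    have h4 := cost_sub_cost hR hP hPK hK hK'
    rw [← hE, ← hS] at h4
    rw [frob_add_left, frob_smul_left, frob_mul_right S, Matrix.transpose_mul,
      Matrix.transpose_transpose, ← Matrix.mul_assoc, ← h4]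
    ring
  have h5 := hasFDerivAt_of_eventually_eq_frob h2 h3
  rw [sub_self, Matrix.zero_mul, Matrix.mul_zero, add_zero, hE] at h5
  exact h5

/-- ⟨U, V⟩ is the trace of √U V √U. -/
theorem frob_nonneg {k : ℕ} {U V : Matrix (Fin k) (Fin k) ℝ} (hU : U.PosSemidef)
    (hV : V.PosSemidef) : 0 ≤ frob U V := by
  have h1 : CFC.sqrt U * CFC.sqrt U = U := CFC.sqrt_mul_sqrt_self U hU.nonneg
  have h2 : (CFC.sqrt U)ᵀ = CFC.sqrt U :=
    (Matrix.nonneg_iff_posSemidef.1 (CFC.sqrt_nonneg U)).isSymm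
  have h3 := (hV.mul_mul_conjTranspose_same (CFC.sqrt U)).trace_nonneg
  rwa [Matrix.conjTranspose_eq_transpose_of_trivial, h2, Matrix.mul_assoc, Matrix.trace_mul_comm,
    Matrix.mul_assoc, h1, Matrix.trace_mul_comm, ← hU.isSymm.eq] at h3

theorem conj_transpose_posSemidef {p q : ℕ} {X : Matrix (Fin q) (Fin q) ℝ} (hX : X.PosSemidef)
    (D : Matrix (Fin p) (Fin q) ℝ) : (D * X * Dᵀ).PosSemidef :=
  hX.mul_mul_conjTranspose_same D

theorem eq_zero_of_trace_conj_eq_zero {p q : ℕ} {X : Matrix (Fin q) (Fin q) ℝ} (hX : X.PosDef)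
    {D : Matrix (Fin p) (Fin q) ℝ} (h : (D * X * Dᵀ).trace = 0) : D = 0 := by
  have h1 := (conj_transpose_posSemidef hX.posSemidef D).trace_eq_zero_iff.1 h
  ext i j
  have h2 : D i ⬝ᵥ X *ᵥ D i = 0 := by
    have := congrFun (congrFun h1 i) i
    rw [Matrix.mul_assoc, Matrix.mul_apply] at this
    simpa [dotProduct, Matrix.mulVec, Matrix.mul_apply] using this
  by_contra hD
  have h3 := hX.dotProduct_mulVec_pos (x := D i) fun h0 => hD (congrFun h0 j)
  rw [star_trivial, h2] at h3
  exact lt_irrefl _ h3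

/-- The pairing is the trace of (√S D) X (√S D)ᵀ. -/
theorem eq_zero_of_frob_conj_eq_zero {p q : ℕ} {S : Matrix (Fin p) (Fin p) ℝ} (hS : S.PosDef)
    {X : Matrix (Fin q) (Fin q) ℝ} (hX : X.PosDef) {D : Matrix (Fin p) (Fin q) ℝ}
    (h : frob S (D * X * Dᵀ) = 0) : D = 0 := by
  have h1 : CFC.sqrt S * CFC.sqrt S = S := CFC.sqrt_mul_sqrt_self S hS.posSemidef.nonneg
  have h2 : (CFC.sqrt S)ᵀ = CFC.sqrt S :=
    (Matrix.nonneg_iff_posSemidef.1 (CFC.sqrt_nonneg S)).isSymm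
  have h3 : CFC.sqrt S * D = 0 := by
    refine eq_zero_of_trace_conj_eq_zero hX ?_
    rw [Matrix.transpose_mul, h2, ← Matrix.mul_assoc, Matrix.trace_mul_comm, ← h, frob,
      hS.posSemidef.isSymm.eq]
    simp only [← Matrix.mul_assoc, h1]
  have h4 : S * D = 0 := by rw [← h1, Matrix.mul_assoc, h3, Matrix.mul_zero]
  have hu := (Matrix.isUnit_iff_isUnit_det _).1 hS.isUnit
  rw [← Matrix.nonsing_inv_mul_cancel_left S D hu, h4, Matrix.mul_zero]

end

end LQR

/-! ### The theorem -/

theorem lemma3 {n m : ℕ} (τ : LQR.TimeModel)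
    (A : Matrix (Fin n) (Fin n) ℝ) (B : Matrix (Fin n) (Fin m) ℝ)
    (Q : Matrix (Fin n) (Fin n) ℝ) (R : Matrix (Fin m) (Fin m) ℝ)
    (W : Matrix (Fin n) (Fin n) ℝ)
    (h₁ : LQR.StandardAssumption τ A B Q R W)
    (h₂ : LQR.LyapunovPosDefAssumption τ A B W) :
    (∀ K ∈ LQR.stabilizingGains τ A B,
      (∃! X, LQR.IsLyapunovSolution τ A B W K X) ∧
      DifferentiableAt ℝ (LQR.cost τ A B Q R W) K) ∧
    (∃! Kstar, LQR.IsOptimalGain τ A B Q R W Kstar) ∧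
    ∀ Kstar, LQR.IsOptimalGain τ A B Q R W Kstar →
      ∀ K ∈ LQR.stabilizingGains τ A B,
        LQR.cost τ A B Q R W K - LQR.optimalValue τ A B Q R W ≥
          LQR.frob R ((K - Kstar) * LQR.lyapunovVar τ A B W K * (K - Kstar)ᵀ) ∧
        LQR.cost τ A B Q R W K - LQR.optimalValue τ A B Q R W ≤
          LQR.frob
            (LQR.matrixGradient (LQR.cost τ A B Q R W) K * (LQR.lyapunovVar τ A B W K)⁻¹ *
              LQR.lyapunovVar τ A B W Kstar)
            (K - Kstar) := by
  have hQ := h₁.Q_posSemidef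
  have hR := h₁.R_posDef
  have hRs := hR.posSemidef.isSymm
  have hW := h₁.W_posSemidef.isSymm
  have hinj : ∀ K ∈ LQR.stabilizingGains τ A B,
      Function.Injective (LQR.lyapOp τ (A + B * K)ᵀ) :=
    fun K hK => LQR.IsStable.lyapOp_transpose_injective hK
  have hsol : ∀ K ∈ LQR.stabilizingGains τ A B,
      LQR.IsLyapunovSolution τ A B W K (LQR.lyapunovVar τ A B W K) := fun K hK =>
    LQR.isLyapunovSolution_lyapunovVar (LQR.existsUnique_isLyapunovSolution hW (hinj K hK)).exists
  -- As `W` is only semidefinite, definiteness of X_K comes from `h₂`; uniqueness and the inverse in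
  -- the upper bound rest on it.
  have hpos : ∀ K ∈ LQR.stabilizingGains τ A B, (LQR.lyapunovVar τ A B W K).PosDef :=
    fun K hK => (h₂ K _ (hsol K hK)).1 hK
  obtain ⟨P, K₀, hP, hK₀, hPK₀, hE₀⟩ :=
    LQR.exists_riccati_solution hQ hR h₁.stabilizable h₁.detectable
  have hdiff : ∀ K ∈ LQR.stabilizingGains τ A B,
      LQR.cost τ A B Q R W K - LQR.cost τ A B Q R W K₀ =
        LQR.frob (LQR.inputWeight τ B R P)
          ((K - K₀) * LQR.lyapunovVar τ A B W K * (K - K₀)ᵀ) := fun K hK => by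
    rw [LQR.cost_sub_cost hRs hP.isSymm hPK₀ (hsol K₀ hK₀) (hsol K hK), hE₀]
    simp [LQR.frob]
  have hconj : ∀ K ∈ LQR.stabilizingGains τ A B, ∀ D : Matrix (Fin m) (Fin n) ℝ,
      (D * LQR.lyapunovVar τ A B W K * Dᵀ).PosSemidef :=
    fun K hK D => LQR.conj_transpose_posSemidef (hpos K hK).posSemidef D
  have hS : ∀ P : Matrix (Fin n) (Fin n) ℝ, P.PosSemidef → (LQR.inputWeight τ B R P).PosDef :=
    fun P hP => LQR.inputWeight_posDef hR hP
  have hopt : LQR.IsOptimalGain τ A B Q R W K₀ := ⟨hK₀, fun K hK => sub_nonneg.1 <| by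
    rw [hdiff K hK]
    exact LQR.frob_nonneg (hS P hP).posSemidef (hconj K hK _)⟩
  have huniq : ∀ K, LQR.IsOptimalGain τ A B Q R W K → K = K₀ := fun K hK => by
    have h : LQR.cost τ A B Q R W K - LQR.cost τ A B Q R W K₀ = 0 :=
      sub_eq_zero.2 (le_antisymm (hK.2 hK₀) (hopt.2 hK.1))
    rw [hdiff K hK.1] at h
    exact sub_eq_zero.1 (LQR.eq_zero_of_frob_conj_eq_zero (hS P hP) (hpos K hK.1) h)
  have hval : LQR.optimalValue τ A B Q R W = LQR.cost τ A B Q R W K₀ := by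
    refine IsLeast.csInf_eq ⟨⟨K₀, hK₀, rfl⟩, ?_⟩
    rintro _ ⟨K, hK, rfl⟩
    exact hopt.2 hK
  refine ⟨fun K hK => ⟨LQR.existsUnique_isLyapunovSolution hW (hinj K hK), ?_⟩,
    ⟨K₀, hopt, huniq⟩, fun Kstar hKstar K hK => ?_⟩
  · obtain ⟨P', hP', hV⟩ := LQR.exists_valueResidual_eq_zero hQ hR hK
    exact (LQR.hasFDerivAt_cost hRs hW hP'.isSymm hV (hinj K hK)).differentiableAt
  · rw [huniq Kstar hKstar, hval]
    constructor
    · rw [hdiff K hK, ge_iff_le, ← sub_nonneg, ← LQR.frob_sub_left]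
      exact LQR.frob_nonneg (LQR.inputWeight_sub_posSemidef hP) (hconj K hK _)
    · obtain ⟨P', hP', hV⟩ := LQR.exists_valueResidual_eq_zero hQ hR hK
      have hu := (Matrix.isUnit_iff_isUnit_det _).1 (hpos K hK).isUnit
      rw [LQR.matrixGradient_eq (LQR.hasFDerivAt_cost hRs hW hP'.isSymm hV (hinj K hK)),
        Matrix.smul_mul, Matrix.mul_nonsing_inv_cancel_right _ _ hu, Matrix.smul_mul,
        LQR.frob_smul_left]
      -- The formula is now based at `K` and evaluated at the optimum `K₀`; its square is dropped.
      have h := LQR.cost_sub_cost hRs hP'.isSymm hV (hsol K hK) (hsol K₀ hK₀)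
      have hnn := LQR.frob_nonneg (hS P' hP').posSemidef (hconj K₀ hK₀ (K₀ - K))
      rw [← neg_sub K K₀, LQR.frob_neg_right, neg_sub K K₀] at h
      linarith
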